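/- Let $q\ge 3$ be a prime power and let $\ell_\infty$ be the line $z=0$ of $\mathrm{PG}(2,q^3)$. An order-$q$-subplane (respectively order-$q$-subline) of $\mathrm{PG}(2,q^3)$ is the set of points whose homogeneous coordinates with respect to three (respectively two) fixed linearly independent vectors of $\mathbb F_{q^3}^3$ can be taken in $\mathbb F_q$. An exterior order-$q$-subplane is an order-$q$-subplane $\pi$ with no point on $\ell_\infty$; its exterior splash is the set of points of $\ell_\infty$ that lie on a line of $\mathrm{PG}(2,q^3)$ joining two distinct points of $\pi$. An exterior splash of $\ell_\infty$ is the exterior splash of some exterior order-$q$-subplane. Let $\mathbb S$ be an exterior splash of $\ell_\infty$. The order-$q$-sublines contained in $\mathbb S$ form two families: if $\pi$ is any exterior order-$q$-subplane with exterior splash $\mathbb S$, one family consists of the $\pi$-pencil-sublines, that is, for each point $P$ of $\pi$, the set of points in which the lines joining $P$ to the other points of $\pi$ meet $\ell_\infty$; the other family consists of the remaining order-$q$-sublines contained in $\mathbb S$. (The unordered pair of families does not depend on $\pi$.) **Theorem.** Let $b_1\neq b_2$ be two distinct order-$q$-sublines of $\mathbb S$ that belong to the same family. If $\mathbb S'$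 is any exterior splash of $\ell_\infty$ containing $b_1$ and $b_2$, then $\mathbb S'=\mathbb S$. -/

import Mathlib

namespace Splash

open LinearAlgebra.Projectivization

/-- The projective plane `PG(2, K)`. In the theorem `F` is the field with `q` elements and `K` is
its cubic extension, so that this is `PG(2, q³)`. -/
abbrev Plane (K : Type*) [Field K] : Type _ := ℙ K (Fin 3 → K)

/-- The line at infinity, with equation `z = 0`. -/
def lineAtInfinity (K : Type*) [Field K] : Set (Plane K) :=
  {P | P.submodule ≤ LinearMap.ker (LinearMap.proj 2 : (Fin 3 → K) →ₗ[K] K)}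

/-- `OnLine P P' Q`: the point `Q` lies on the line of `PG(2, K)` joining `P` and `P'`
(used for `P ≠ P'`). -/
def OnLine {K : Type*} [Field K] (P P' Q : Plane K) : Prop :=
  Q.submodule ≤ P.submodule ⊔ P'.submodule

/-- The points with homogeneous coordinates in the subfield `F` with respect to the
vectors `e`. -/
def subgeometry (F : Type*) {K : Type*} [Field F] [Field K] [Algebra F K] {n : ℕ}
    (e : Fin n → Fin 3 → K) : Set (Plane K) :=
  {P | ∃ (c : Fin n → F) (h : ∑ i, c i • e i ≠ 0), P = Projectivization.mk K (∑ i, c i • e i) h}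

/-- Order-`q`-sublines of `PG(2, K)`: copies of `PG(1, F)` contained in some line. -/
def IsSubline (F : Type*) {K : Type*} [Field F] [Field K] [Algebra F K]
    (b : Set (Plane K)) : Prop :=
  ∃ e : Fin 2 → Fin 3 → K, LinearIndependent K e ∧ b = subgeometry F e

/-- Order-`q`-subplanes of `PG(2, K)`: images of `PG(2, F)` under homographies of `PG(2, K)`
(the vectors `e` are the columns of the matrix). -/
def IsSubplane (F : Type*) {K : Type*} [Field F] [Field K] [Algebra F K]
    (π : Set (Plane K)) : Prop :=
  ∃ e : Fin 3 → Fin 3 → K, LinearIndependent K e ∧ π = subgeometry F e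

/-- Order-`q`-subplanes having no point on the line at infinity. -/
def IsExteriorSubplane (F : Type*) {K : Type*} [Field F] [Field K] [Algebra F K]
    (π : Set (Plane K)) : Prop :=
  IsSubplane F π ∧ Disjoint π (lineAtInfinity K)

/-- The points of the line at infinity that lie on an extended line of `π`, that is, on the line
joining two distinct points of `π`. -/
def splash {K : Type*} [Field K] (π : Set (Plane K)) : Set (Plane K) :=
  {Q | Q ∈ lineAtInfinity K ∧ ∃ P ∈ π, ∃ P' ∈ π, P ≠ P' ∧ OnLine P P' Q}

/-- Exterior splashes of the line at infinity. -/
def IsExteriorSplash (F : Type*) {K : Type*} [Field F] [Field K] [Algebra F K]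
    (S : Set (Plane K)) : Prop :=
  ∃ π : Set (Plane K), IsExteriorSubplane F π ∧ S = splash π

/-- The points in which the lines of `π` through the point `P` of `π` meet the line at
infinity. -/
def pencilSubline {K : Type*} [Field K] (π : Set (Plane K)) (P : Plane K) : Set (Plane K) :=
  {Q | Q ∈ lineAtInfinity K ∧ ∃ P' ∈ π, P ≠ P' ∧ OnLine P P' Q}

/-- The order-`q`-sublines contained in the point set `S`. -/
def sublinesOf (F : Type*) {K : Type*} [Field F] [Field K] [Algebra F K]
    (S : Set (Plane K)) : Set (Set (Plane K)) :=
  {b | IsSubline F b ∧ b ⊆ S}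

/-- The `π`-pencil-sublines. -/
def pencilFamily {K : Type*} [Field K] (π : Set (Plane K)) : Set (Set (Plane K)) :=
  {b | ∃ P ∈ π, b = pencilSubline π P}

/-- `IsFamily F S B`: `B` is one of the two families of order-`q`-sublines of the exterior
splash `S`. Relative to an exterior order-`q`-subplane `π` with exterior splash `S`, one family
consists of the `π`-pencil-sublines and the other one of the remaining order-`q`-sublines
of `S`. -/
def IsFamily (F : Type*) {K : Type*} [Field F] [Field K] [Algebra F K]
    (S : Set (Plane K)) (B : Set (Set (Plane K))) : Prop :=
  ∃ π : Set (Plane K), IsExteriorSubplane F π ∧ S = splash π ∧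
    (B = pencilFamily π ∨ B = sublinesOf F S \ pencilFamily π)

end Splash

/-! Let `σ` generate the Galois group of `K` over `F`, and let N be the norm. The z-coordinates of
an exterior subplane form a copy of `K`, so its points are x w₀ + σ(x) w₁ - σ²(x) w₂ with w₁, w₂
spanning z = 0. Joining the points of parameters x and y gives t w₁ + σ²(t) w₂ with t = y σ(x) - x
σ(y). Hence the splash is the set of points X w₁ + Y w₂ with N(X) = N(Y) (Hilbert 90), and the
pencil sublines are its subsets given by the 2-dimensional F-spaces of t (`splash_eq`,
`mem_pencilFamily_iff`). On any subline of the splash the binary cubic N(X) - N(Y) vanishes at q + 1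
> 3 points, hence identically; factoring it shows that the other family arises by exchanging w₁ and
w₂ (`IsSubline.eq_twisted`).

A second splash is given in the same coordinates by N(αX + γY) = N(βX + δY). If it contains the
subline of an F-plane W, its mixed coefficients satisfy a linear relation that determines W
(`coeff_relation`). Two distinct planes force all mixed coefficients to vanish, and the form becomes
a nonzero multiple of N(X) - N(Y) (`twisted_top_eq_of_subset`). The second family follows from the
symmetry of N(X) = N(Y). -/

namespace Splash

open LinearAlgebra.Projectivization

variable {F K : Type*} [Field F] [Field K] [Algebra F K]

/-! ### Trace, norm and F-planes in a cyclic cubic extension. -/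

/-- `σ` generates the Galois group of a cyclic cubic extension `K / F`. -/
structure IsCubicGenerator (σ : K →ₐ[F] K) : Prop where
  cube : ∀ x, σ (σ (σ x)) = x
  fixed : ∀ x, σ x = x → ∃ c : F, algebraMap F K c = x
  indep : ∀ a b c : K, (∀ x, a * x + b * σ x + c * σ (σ x) = 0) → a = 0 ∧ b = 0 ∧ c = 0

theorem exists_isCubicGenerator [Finite F] (hK : Module.finrank F K = 3) :
    ∃ σ : K →ₐ[F] K, IsCubicGenerator σ := by
  have := Fintype.ofFinite F
  have : FiniteDimensional F K := Module.finite_of_finrank_pos (by omega)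
  have : Finite K := Module.finite_of_finite F
  have hb := FiniteField.bijective_frobeniusAlgHom_pow F K
  have ho := FiniteField.orderOf_frobeniusAlgHom F K
  rw [hK] at hb ho
  refine ⟨FiniteField.frobeniusAlgHom F K, fun x ↦ ?_, fun x hx ↦ ?_, fun a b c h ↦ ?_⟩
  · have h := pow_orderOf_eq_one (FiniteField.frobeniusAlgHom F K)
    rw [ho] at h
    simpa [pow_succ] using DFunLike.congr_fun h x
  · have : IsGalois F K := inferInstance
    have hm : x ∈ (⊥ : IntermediateField F K) := by
      rw [IsGalois.mem_bot_iff_fixed]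
      intro f
      obtain ⟨n, hn⟩ := hb.2 (f : K →ₐ[F] K)
      have h1 : f x = (FiniteField.frobeniusAlgHom F K ^ n.1) x := by
        simpa using (DFunLike.congr_fun hn x).symm
      rw [h1]
      have : ∀ m : ℕ, (FiniteField.frobeniusAlgHom F K ^ m) x = x := by
        intro m
        induction m with
        | zero => simp
        | succ m ih => rw [pow_succ, AlgHom.mul_apply, hx, ih]
      exact this _
    exact IntermediateField.mem_bot.1 hm
  -- Dedekind independence of the three distinct powers of Frobenius.
  · have hl := (linearIndependent_toLinearMap F K K).comp _ hb.1
    rw [Fintype.linearIndependent_iff] at hl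
    have := hl ![a, b, c] (by
      ext x
      simpa [Fin.sum_univ_three, pow_succ] using h x)
    exact ⟨this 0, this 1, this 2⟩

/-- The norm form `x σ(x) σ²(x)`. -/
def normForm (σ : K →ₐ[F] K) (x : K) : K := x * σ x * σ (σ x)

/-- The trace-zero line `{t | Tr (a t) = 0}` of the `F`-plane `K`. -/
def traceLine (σ : K →ₐ[F] K) (a : K) : Submodule F K :=
  LinearMap.ker ((LinearMap.id + σ.toLinearMap + σ.toLinearMap ∘ₗ σ.toLinearMap) ∘ₗ
    LinearMap.mulLeft F a)

/-- The map `y ↦ y σ(x) - x σ(y)`. -/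
def wedge (σ : K →ₐ[F] K) (x : K) : K →ₗ[F] K :=
  LinearMap.mulLeft F (σ x) - LinearMap.mulLeft F x ∘ₗ σ.toLinearMap

theorem wedge_apply (σ : K →ₐ[F] K) (x y : K) : wedge σ x y = y * σ x - x * σ y := by
  simp [wedge, mul_comm]

theorem mem_traceLine (σ : K →ₐ[F] K) (a t : K) :
    t ∈ traceLine σ a ↔ a * t + σ a * σ t + σ (σ a) * σ (σ t) = 0 := by
  simp [traceLine]

namespace IsCubicGenerator

variable {σ : K →ₐ[F] K} (hσ : IsCubicGenerator σ)
include hσ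

/-- The map t ↦ Tr(at) takes values in `F` and is nonzero by independence of the conjugates, so its
kernel has codimension 1. -/
theorem finrank_traceLine (hK : Module.finrank F K = 3) {a : K} (ha : a ≠ 0) :
    Module.finrank F (traceLine σ a) = 2 := by
  have : FiniteDimensional F K := Module.finite_of_finrank_pos (by omega)
  set φ := ((LinearMap.id + σ.toLinearMap + σ.toLinearMap ∘ₗ σ.toLinearMap) ∘ₗ
    LinearMap.mulLeft F a) with hφ
  have happ : ∀ t, φ t = a * t + σ a * σ t + σ (σ a) * σ (σ t) := by simp [hφ]
  have h1 := LinearMap.finrank_range_add_finrank_ker φ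
  have hr : LinearMap.range φ ≤ Submodule.span F {1} := by
    rintro _ ⟨t, rfl⟩
    obtain ⟨c, hc⟩ := hσ.fixed (φ t) (by
      rw [happ]; simp only [map_add, map_mul, hσ.cube]; ring)
    rw [← hc, Submodule.mem_span_singleton]
    exact ⟨c, by rw [Algebra.smul_def, mul_one]⟩
  have h2 : Module.finrank F (LinearMap.range φ) ≤ 1 :=
    (Submodule.finrank_mono hr).trans (finrank_span_le_card _ |>.trans (by simp))
  have h3 : Module.finrank F (LinearMap.range φ) ≠ 0 := by
    intro h
    rw [Submodule.finrank_eq_zero, LinearMap.range_eq_bot] at h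
    exact ha (hσ.indep a (σ a) (σ (σ a)) fun x ↦ by
      rw [← happ, h, LinearMap.zero_apply]).1
  change Module.finrank F (LinearMap.ker φ) = 2
  omega

/-- One inclusion is an identity; equality follows by dimension, since the kernel of `wedge σ x`
lies in F·x. -/
theorem range_wedge (hK : Module.finrank F K = 3) {x : K} (hx : x ≠ 0) :
    LinearMap.range (wedge σ x) = traceLine σ (σ (σ x)) := by
  have : FiniteDimensional F K := Module.finite_of_finrank_pos (by omega)
  apply Submodule.eq_of_le_of_finrank_le
  · rintro _ ⟨y, rfl⟩
    rw [mem_traceLine, wedge_apply]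
    simp only [map_sub, map_mul, hσ.cube]
    ring
  · rw [hσ.finrank_traceLine hK (by simpa using hx)]
    have h1 := LinearMap.finrank_range_add_finrank_ker (wedge σ x)
    have hk : LinearMap.ker (wedge σ x) ≤ Submodule.span F {x} := by
      intro y hy
      rw [LinearMap.mem_ker, wedge_apply] at hy
      have hx' : σ x ≠ 0 := by simpa using hx
      obtain ⟨c, hc⟩ := hσ.fixed (y / x) (by
        rw [map_div₀, div_eq_div_iff hx' hx]; linear_combination -hy)
      rw [Submodule.mem_span_singleton]
      exact ⟨c, by rw [Algebra.smul_def, hc, div_mul_cancel₀ _ hx]⟩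
    have h2 : Module.finrank F (LinearMap.ker (wedge σ x)) ≤ 1 :=
      (Submodule.finrank_mono hk).trans (finrank_span_le_card _ |>.trans (by simp))
    omega

theorem exists_span_pair {W : Submodule F K} (hW : Module.finrank F W = 2) :
    ∃ e₁ ∈ W, ∃ e₂ ∈ W, W = Submodule.span F {e₁, e₂} ∧ wedge σ e₂ e₁ ≠ 0 := by
  have : FiniteDimensional F W := Module.finite_of_finrank_pos (by omega)
  let b := Module.finBasisOfFinrankEq F W hW
  have hs : W = Submodule.span F {(b 0 : K), (b 1 : K)} := by
    have := congrArg (Submodule.map W.subtype) b.span_eq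
    rw [Submodule.map_top, Submodule.range_subtype, Submodule.map_span] at this
    refine this.symm.trans (congrArg _ ?_)
    ext x
    simp [Fin.exists_fin_two, eq_comm]
  refine ⟨b 0, (b 0).2, b 1, (b 1).2, hs, fun h ↦ ?_⟩
  rw [wedge_apply] at h
  have h1 : (b 1 : K) ≠ 0 := by simpa using b.ne_zero 1
  have h1' : σ (b 1 : K) ≠ 0 := by simpa using h1
  obtain ⟨c, hc⟩ := hσ.fixed ((b 0 : K) / b 1) (by
    rw [map_div₀, div_eq_div_iff h1' h1]; linear_combination -h)
  have hlin := b.linearIndependent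
  rw [Fintype.linearIndependent_iff] at hlin
  have := hlin ![1, -c] (by
    apply Subtype.ext
    simp [Fin.sum_univ_two, Algebra.smul_def, hc, div_mul_cancel₀ _ h1]) 0
  simp at this

/-- With w = `wedge σ e₂ e₁`, the triple (σ(w), σ²(w), w) is the cross product of (e₁, σ(e₁),
σ²(e₁)) and (e₂, σ(e₂), σ²(e₂)). Thus w encodes the plane. -/
theorem span_pair_eq_traceLine (hK : Module.finrank F K = 3) {e₁ e₂ : K}
    (h : wedge σ e₂ e₁ ≠ 0) :
    Submodule.span F {e₁, e₂} = traceLine σ (σ (wedge σ e₂ e₁)) := by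
  have : FiniteDimensional F K := Module.finite_of_finrank_pos (by omega)
  apply Submodule.eq_of_le_of_finrank_le
  · rw [Submodule.span_le]
    rintro _ (rfl | rfl) <;>
    · simp only [SetLike.mem_coe, mem_traceLine, wedge_apply, map_sub, map_mul, hσ.cube]
      ring
  · rw [hσ.finrank_traceLine hK (by simpa using h)]
    have hl : LinearIndependent F ![e₁, e₂] := by
      rw [LinearIndependent.pair_iff]
      intro s t hst
      have hst' := congrArg σ hst
      simp only [Algebra.smul_def, map_add, map_mul, AlgHom.commutes, map_zero] at hst hst'
      rw [wedge_apply] at h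
      constructor
      · have : algebraMap F K s * (e₁ * σ e₂ - e₂ * σ e₁) = 0 := by
          linear_combination σ e₂ * hst - e₂ * hst'
        simpa [h] using this
      · have : algebraMap F K t * (e₁ * σ e₂ - e₂ * σ e₁) = 0 := by
          linear_combination - σ e₁ * hst + e₁ * hst'
        simpa [h] using this
    have := finrank_span_eq_card hl
    rw [Matrix.range_cons, Matrix.range_cons, Matrix.range_empty, Set.union_empty,
      Set.singleton_union] at this
    rw [this, Fintype.card_fin]

theorem finrank_span_pair (hK : Module.finrank F K = 3) {e₁ e₂ : K}
    (h : wedge σ e₂ e₁ ≠ 0) : Module.finrank F (Submodule.span F {e₁, e₂}) = 2 := by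
  rw [hσ.span_pair_eq_traceLine hK h, hσ.finrank_traceLine hK (by simpa using h)]

theorem traceLine_eq_of_proportional {a b : K} (ha : a ≠ 0) (hb : b ≠ 0)
    (h : a * σ b = b * σ a) : traceLine σ a = traceLine σ b := by
  have ha' : σ a ≠ 0 := by simpa using ha
  obtain ⟨c, hc⟩ := hσ.fixed (b / a) (by
    rw [map_div₀, div_eq_div_iff ha' ha]; linear_combination h)
  have hba : b = algebraMap F K c * a := by rw [hc, div_mul_cancel₀ _ ha]
  have hc0 : algebraMap F K c ≠ 0 := by rintro h0; apply hb; rw [hba, h0, zero_mul]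
  ext t
  rw [mem_traceLine, mem_traceLine, hba]
  simp only [map_mul, AlgHom.commutes]
  rw [← mul_eq_zero_iff_left hc0]
  ring_nf

/-- Hilbert's Theorem 90 for the square of the generator. -/
theorem exists_eq_mul_of_normForm_eq_one {k : K} (hk : normForm σ k = 1) :
    ∃ m : K, m ≠ 0 ∧ σ (σ m) = k * m := by
  -- A Lagrange resolvent: applying σ² multiplies it by `k` because `k` has norm 1.
  obtain ⟨x, hx⟩ : ∃ x, σ k * x + σ k * σ (σ k) * σ x + 1 * σ (σ x) ≠ 0 := by
    by_contra! h
    exact one_ne_zero (hσ.indep _ _ _ h).2.2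
  rw [normForm] at hk
  refine ⟨_, hx, ?_⟩
  simp only [map_add, map_mul, map_one, hσ.cube]
  linear_combination -(σ x) * hk

end IsCubicGenerator

/-! ### Binary cubic forms arising from norms. -/

/-- A binary cubic form vanishing on all points of the projective line over a field with more than
two elements is zero. -/
theorem binary_cubic_eq_zero [Finite F] (hq : 2 < Nat.card F) {A B C D : K}
    (h : ∀ r s : F, A * algebraMap F K r ^ 3 + B * algebraMap F K r ^ 2 * algebraMap F K s +
      C * algebraMap F K r * algebraMap F K s ^ 2 + D * algebraMap F K s ^ 3 = 0) :
    A = 0 ∧ B = 0 ∧ C = 0 ∧ D = 0 := by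
  have hA := h 1 0
  have hD := h 0 1
  have hBC := h 1 1
  simp at hA hD hBC
  -- A fourth point (r : 1) of the projective line, beyond (1 : 0), (0 : 1), (1 : 1); this needs q >
  -- 2.
  obtain ⟨r, hr⟩ : ∃ r : F, r ≠ 0 ∧ r ≠ 1 := by
    classical
    have := Fintype.ofFinite F
    rw [Nat.card_eq_fintype_card] at hq
    obtain ⟨r, hr⟩ := Finset.exists_mem_notMem_of_card_lt_card
      (s := ({0, 1} : Finset F)) (t := Finset.univ) (by
        rw [Finset.card_univ]; exact Finset.card_le_two.trans_lt hq)
    exact ⟨r, by simpa using hr.2⟩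
  have hr0 : algebraMap F K r ≠ 0 := by simpa using hr.1
  have hr1 : algebraMap F K r - 1 ≠ 0 := by
    rw [sub_ne_zero]; exact fun h ↦ hr.2 ((algebraMap F K).injective (by simpa using h))
  have h1 := h r 1
  subst hA hD
  simp at h1 hBC
  have hB : algebraMap F K r * (algebraMap F K r - 1) * B = 0 := by
    linear_combination h1 - algebraMap F K r * hBC
  have hB0 : B = 0 := by simpa [hr0, hr1] using hB
  subst hB0
  exact ⟨rfl, rfl, by simpa using hBC, rfl⟩

theorem normForm_mul (σ : K →ₐ[F] K) (x y : K) :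
    normForm σ (x * y) = normForm σ x * normForm σ y := by
  simp only [normForm, map_mul]; ring

theorem normForm_eq_zero (σ : K →ₐ[F] K) {x : K} : normForm σ x = 0 ↔ x = 0 := by
  simp [normForm]

/-- Equality of two norms on an `F`-plane holds identically in `K`. -/
theorem normForm_identity [Finite F] (hq : 2 < Nat.card F) {σ : K →ₐ[F] K} {x₀ x₁ y₀ y₁ : K}
    (hN : ∀ r s : F, normForm σ (algebraMap F K r * x₀ + algebraMap F K s * x₁) =
      normForm σ (algebraMap F K r * y₀ + algebraMap F K s * y₁)) (r s : K) :
    (r * x₀ + s * x₁) * (r * σ x₀ + s * σ x₁) * (r * σ (σ x₀) + s * σ (σ x₁)) =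
      (r * y₀ + s * y₁) * (r * σ y₀ + s * σ y₁) * (r * σ (σ y₀) + s * σ (σ y₁)) := by
  obtain ⟨hA, hB, hC, hD⟩ := binary_cubic_eq_zero (K := K) hq
    (A := x₀ * σ x₀ * σ (σ x₀) - y₀ * σ y₀ * σ (σ y₀))
    (B := x₀ * σ x₀ * σ (σ x₁) + x₀ * σ x₁ * σ (σ x₀) + x₁ * σ x₀ * σ (σ x₀) -
      (y₀ * σ y₀ * σ (σ y₁) + y₀ * σ y₁ * σ (σ y₀) + y₁ * σ y₀ * σ (σ y₀)))
    (C := x₀ * σ x₁ * σ (σ x₁) + x₁ * σ x₁ * σ (σ x₀) + x₁ * σ x₀ * σ (σ x₁) -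
      (y₀ * σ y₁ * σ (σ y₁) + y₁ * σ y₁ * σ (σ y₀) + y₁ * σ y₀ * σ (σ y₁)))
    (D := x₁ * σ x₁ * σ (σ x₁) - y₁ * σ y₁ * σ (σ y₁)) (by
      intro a b
      have h := hN a b
      simp only [normForm, map_add, map_mul, AlgHom.commutes] at h
      linear_combination h)
  linear_combination r ^ 3 * hA + r ^ 2 * s * hB + r * s ^ 2 * hC + s ^ 3 * hD

/-! ### Splashes as norm equations on the line at infinity. -/

/-- The vectors `u₁, u₂` form a basis of the plane `z = 0`. -/
structure IsInftyBasis (u₁ u₂ : Fin 3 → K) : Prop where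
  left : u₁ 2 = 0
  right : u₂ 2 = 0
  indep : ∀ a b : K, a • u₁ + b • u₂ = 0 → a = 0 ∧ b = 0
  span : ∀ v : Fin 3 → K, v 2 = 0 → ∃ a b : K, v = a • u₁ + b • u₂

namespace IsInftyBasis

variable {u₁ u₂ : Fin 3 → K} (hu : IsInftyBasis u₁ u₂)
include hu

theorem symm : IsInftyBasis u₂ u₁ where
  left := hu.right
  right := hu.left
  indep a b h := (hu.indep b a (by rw [add_comm]; exact h)).symm
  span v hv := by
    obtain ⟨a, b, h⟩ := hu.span v hv
    exact ⟨b, a, by rw [h, add_comm]⟩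

theorem eq_of_eq {a b c d : K} (h : a • u₁ + b • u₂ = c • u₁ + d • u₂) : a = c ∧ b = d := by
  have := hu.indep (a - c) (b - d) (by
    rw [sub_smul, sub_smul]
    linear_combination (exp := 1) h)
  exact ⟨sub_eq_zero.1 this.1, sub_eq_zero.1 this.2⟩

end IsInftyBasis

/-- The points `⟨t u₁ + σ²(t) u₂⟩` with `t` in the `F`-subspace `W` of `K`. -/
def twisted (σ : K →ₐ[F] K) (u₁ u₂ : Fin 3 → K) (W : Submodule F K) : Set (Plane K) :=
  {P | ∃ t ∈ W, ∃ h : t • u₁ + σ (σ t) • u₂ ≠ 0, P = Projectivization.mk K _ h}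

variable {σ : K →ₐ[F] K} {u₁ u₂ : Fin 3 → K}

theorem mk_mem_twisted (hu : IsInftyBasis u₁ u₂) {W : Submodule F K} {X Y : K} {v : Fin 3 → K}
    (hv : v ≠ 0) (hX : v = X • u₁ + Y • u₂) :
    Projectivization.mk K v hv ∈ twisted σ u₁ u₂ W ↔
      ∃ k, ∃ t ∈ W, X = k * t ∧ Y = k * σ (σ t) := by
  subst hX
  constructor
  · rintro ⟨t, ht, h, hP⟩
    rw [Projectivization.mk_eq_mk_iff'] at hP
    obtain ⟨k, hk⟩ := hP
    rw [smul_add, smul_smul, smul_smul] at hk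
    have := hu.eq_of_eq hk
    exact ⟨k, t, ht, this.1.symm, this.2.symm⟩
  · rintro ⟨k, t, ht, rfl, rfl⟩
    have h : (k * t) • u₁ + (k * σ (σ t)) • u₂ = k • (t • u₁ + σ (σ t) • u₂) := by
      rw [smul_add, smul_smul, smul_smul]
    refine ⟨t, ht, fun h0 ↦ hv (by rw [h, h0, smul_zero]), ?_⟩
    rw [Projectivization.mk_eq_mk_iff']
    exact ⟨k, h.symm⟩

/-- If N(X) = N(Y), then Y/X has norm 1, so Hilbert 90 writes it as σ²(m)/m, and m is the required
parameter. -/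
theorem mk_mem_twisted_top (hσ : IsCubicGenerator σ) (hu : IsInftyBasis u₁ u₂) {X Y : K}
    {v : Fin 3 → K} (hv : v ≠ 0) (hX : v = X • u₁ + Y • u₂) :
    Projectivization.mk K v hv ∈ twisted σ u₁ u₂ ⊤ ↔ normForm σ X = normForm σ Y := by
  rw [mk_mem_twisted hu hv hX]
  constructor
  · rintro ⟨k, t, -, rfl, rfl⟩
    simp only [normForm, map_mul, hσ.cube]
    ring
  · intro h
    have hX0 : X ≠ 0 := by
      rintro rfl
      rw [(normForm_eq_zero σ).2 rfl, eq_comm, normForm_eq_zero] at h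
      apply hv
      rw [hX, h, zero_smul, zero_smul, add_zero]
    have hN : normForm σ (Y / X) = 1 := by
      have h1 := normForm_mul σ (Y / X) X
      rw [div_mul_cancel₀ _ hX0, ← h] at h1
      exact (right_eq_mul₀ (mt (normForm_eq_zero σ).1 hX0)).1 h1
    obtain ⟨m, hm, hmk⟩ := hσ.exists_eq_mul_of_normForm_eq_one hN
    refine ⟨X / m, m, trivial, (div_mul_cancel₀ _ hm).symm, ?_⟩
    rw [hmk]
    field_simp

theorem exists_coords_of_mk_mem_twisted {W : Submodule F K} {v : Fin 3 → K} (hv : v ≠ 0)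
    (h : Projectivization.mk K v hv ∈ twisted σ u₁ u₂ W) : ∃ X Y : K, v = X • u₁ + Y • u₂ := by
  obtain ⟨t, -, ht, hP⟩ := h
  rw [Projectivization.mk_eq_mk_iff'] at hP
  obtain ⟨k, hk⟩ := hP
  exact ⟨k * t, k * σ (σ t), by rw [← hk, smul_add, smul_smul, smul_smul]⟩

theorem twisted_mono {W W' : Submodule F K} (h : W ≤ W') :
    twisted σ u₁ u₂ W ⊆ twisted σ u₁ u₂ W' := by
  rintro _ ⟨t, ht, h0, rfl⟩
  exact ⟨t, h ht, h0, rfl⟩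

theorem twisted_top_comm (hσ : IsCubicGenerator σ) (hu : IsInftyBasis u₁ u₂) :
    twisted σ u₂ u₁ ⊤ = twisted σ u₁ u₂ ⊤ := by
  ext P
  induction P using Projectivization.ind with
  | h v hv =>
    constructor <;> intro h <;> obtain ⟨X, Y, hX⟩ := exists_coords_of_mk_mem_twisted hv h
    · rw [mk_mem_twisted_top hσ hu.symm hv hX] at h
      rw [mk_mem_twisted_top hσ hu hv (by rw [hX, add_comm]), h]
    · rw [mk_mem_twisted_top hσ hu hv hX] at h
      rw [mk_mem_twisted_top hσ hu.symm hv (by rw [hX, add_comm]), h]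

/-! ### The sublines contained in a splash. -/

section Classification

variable {e : Fin 2 → Fin 3 → K} {x₀ x₁ y₀ y₁ : K}

/-- Hypothesis `h` says y₁/y₀ = σ²(x₁/x₀), up to clearing denominators, so yᵢ = k σ²(xᵢ) with one
common `k` of norm 1. Writing k = σ²(m)/m and rescaling by `m` absorbs it. -/
theorem subgeometry_eq_twisted (hσ : IsCubicGenerator σ) (hK : Module.finrank F K = 3)
    (he₀ : e 0 = x₀ • u₁ + y₀ • u₂) (he₁ : e 1 = x₁ • u₁ + y₁ • u₂)
    (hx₀ : x₀ ≠ 0) (hN : normForm σ x₀ = normForm σ y₀)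
    (h : x₀ * σ y₁ = x₁ * σ y₀) (hne : x₀ * y₁ ≠ x₁ * y₀) :
    ∃ W : Submodule F K, Module.finrank F W = 2 ∧ subgeometry F e = twisted σ u₁ u₂ W := by
  have hx₀' : σ (σ x₀) ≠ 0 := by simpa using hx₀
  have h' : σ (σ x₀) * y₁ = σ (σ x₁) * y₀ := by
    simpa [hσ.cube] using congrArg (fun z ↦ σ (σ z)) h
  obtain ⟨k, hk⟩ : ∃ k, k * σ (σ x₀) = y₀ := ⟨y₀ / σ (σ x₀), div_mul_cancel₀ _ hx₀'⟩
  have hk₁ : k * σ (σ x₁) = y₁ := by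
    apply mul_left_cancel₀ hx₀'
    rw [h', ← hk]; ring
  have hkN : normForm σ k = 1 := by
    have h1 : normForm σ (σ (σ x₀)) = normForm σ x₀ := by
      simp only [normForm, hσ.cube]; ring
    rw [← hk, normForm_mul, h1] at hN
    exact (right_eq_mul₀ (mt (normForm_eq_zero σ).1 hx₀)).1 hN
  obtain ⟨m, hm, hmk⟩ := hσ.exists_eq_mul_of_normForm_eq_one hkN
  have hw : wedge σ (m * x₁) (m * x₀) ≠ 0 := by
    intro h0
    have h1 : m * σ m * (x₀ * σ x₁ - x₁ * σ x₀) = 0 := by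
      rw [← h0, wedge_apply, map_mul, map_mul]; ring
    have h2 : x₀ * σ x₁ - x₁ * σ x₀ = 0 := by simpa [hm] using h1
    have h3 := congrArg (fun z ↦ σ (σ z)) h2
    simp only [map_sub, map_mul, hσ.cube, map_zero] at h3
    apply hne
    rw [← hk, ← hk₁]
    linear_combination -k * h3
  refine ⟨Submodule.span F {m * x₀, m * x₁}, hσ.finrank_span_pair hK hw, ?_⟩
  have key : ∀ a b : F, m • (a • e 0 + b • e 1) = (a • (m * x₀) + b • (m * x₁)) • u₁ +
      σ (σ (a • (m * x₀) + b • (m * x₁))) • u₂ := by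
    intro a b
    rw [he₀, he₁, ← hk, ← hk₁]
    ext i
    simp only [Pi.smul_apply, Pi.add_apply, smul_eq_mul]
    simp only [Algebra.smul_def, map_add, map_mul, AlgHom.commutes, hmk]
    ring
  ext P
  constructor
  · rintro ⟨c, h0, rfl⟩
    simp only [Fin.sum_univ_two] at h0 ⊢
    refine ⟨_, Submodule.mem_span_pair.2 ⟨c 0, c 1, rfl⟩, ?_, ?_⟩
    · rw [← key]
      exact smul_ne_zero hm h0
    · rw [Projectivization.mk_eq_mk_iff']
      exact ⟨m⁻¹, by rw [← key, inv_smul_smul₀ hm]⟩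
  · rintro ⟨t, ht, h0, rfl⟩
    obtain ⟨a, b, rfl⟩ := Submodule.mem_span_pair.1 ht
    refine ⟨![a, b], ?_, ?_⟩
    · rw [← key] at h0
      simpa [Fin.sum_univ_two] using (smul_ne_zero_iff.1 h0).2
    · rw [Projectivization.mk_eq_mk_iff']
      exact ⟨m, by rw [← key]; simp [Fin.sum_univ_two]⟩

theorem IsSubline.eq_twisted [Finite F] (hq : 2 < Nat.card F) (hK : Module.finrank F K = 3)
    (hσ : IsCubicGenerator σ) (hu : IsInftyBasis u₁ u₂) {b : Set (Plane K)}
    (hb : IsSubline F b) (hbS : b ⊆ twisted σ u₁ u₂ ⊤) :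
    ∃ W : Submodule F K, Module.finrank F W = 2 ∧
      (b = twisted σ u₁ u₂ W ∨ b = twisted σ u₂ u₁ W) := by
  obtain ⟨e, he, rfl⟩ := hb
  have hli : ∀ a c : K, a • e 0 + c • e 1 = 0 → a = 0 ∧ c = 0 := by
    intro a c hac
    have h1 := Fintype.linearIndependent_iff.1 he ![a, c] (by simpa [Fin.sum_univ_two] using hac)
    exact ⟨h1 0, h1 1⟩
  have hmem : ∀ a c : F, ∀ h : a • e 0 + c • e 1 ≠ 0,
      Projectivization.mk K _ h ∈ twisted σ u₁ u₂ ⊤ := fun a c h ↦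
    hbS ⟨![a, c], by simpa [Fin.sum_univ_two] using h, by simp [Fin.sum_univ_two]⟩
  have hc : ∀ i, ∃ X Y : K, e i = X • u₁ + Y • u₂ := by
    have h₀ := hmem 1 0 (by simpa using he.ne_zero 0)
    have h₁ := hmem 0 1 (by simpa using he.ne_zero 1)
    intro i
    fin_cases i
    · simpa using exists_coords_of_mk_mem_twisted _ h₀
    · simpa using exists_coords_of_mk_mem_twisted _ h₁
  obtain ⟨x₀, y₀, he₀⟩ := hc 0
  obtain ⟨x₁, y₁, he₁⟩ := hc 1
  have hN : ∀ r s : F, normForm σ (algebraMap F K r * x₀ + algebraMap F K s * x₁) =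
      normForm σ (algebraMap F K r * y₀ + algebraMap F K s * y₁) := by
    intro r s
    by_cases h : r • e 0 + s • e 1 = 0
    · have h1 := hli (algebraMap F K r) (algebraMap F K s) (by
        rwa [algebraMap_smul, algebraMap_smul])
      rw [h1.1, h1.2]
      simp
    · refine (mk_mem_twisted_top hσ hu h ?_).1 (hmem r s h)
      rw [he₀, he₁]
      ext i
      simp only [Pi.smul_apply, Pi.add_apply, smul_eq_mul]
      simp only [Algebra.smul_def]
      ring
  have hne : x₀ * y₁ ≠ x₁ * y₀ := by
    intro h
    have h1 := hli x₁ (-x₀) (by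
      rw [he₀, he₁]
      ext i
      simp only [Pi.smul_apply, Pi.add_apply, smul_eq_mul, Pi.zero_apply]
      linear_combination -u₂ i * h)
    have h2 := hli y₁ (-y₀) (by
      rw [he₀, he₁]
      ext i
      simp only [Pi.smul_apply, Pi.add_apply, smul_eq_mul, Pi.zero_apply]
      linear_combination u₁ i * h)
    apply he.ne_zero 0
    rw [he₀, neg_eq_zero.1 h1.2, neg_eq_zero.1 h2.2, zero_smul, zero_smul, add_zero]
  have hN₀ : normForm σ x₀ = normForm σ y₀ := by simpa using hN 1 0
  have hx₀ : x₀ ≠ 0 := by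
    rintro rfl
    rw [(normForm_eq_zero σ).2 rfl, eq_comm, normForm_eq_zero] at hN₀
    exact he.ne_zero 0 (by rw [he₀, hN₀, zero_smul, zero_smul, add_zero])
  have hy₀ : y₀ ≠ 0 := by
    rintro rfl
    rw [(normForm_eq_zero σ).2 rfl, normForm_eq_zero] at hN₀
    exact hx₀ hN₀
  -- At (r, s) = (-x₁, x₀) the left side of the identity vanishes and the right side is a product of
  -- three determinants.
  have hprod : (x₀ * y₁ - x₁ * y₀) * ((x₀ * σ y₁ - x₁ * σ y₀) *
      (x₀ * σ (σ y₁) - x₁ * σ (σ y₀))) = 0 := by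
    linear_combination -normForm_identity hq hN (-x₁) x₀
  rcases mul_eq_zero.1 ((mul_eq_zero.1 hprod).resolve_left (sub_ne_zero.2 hne)) with h | h
  · obtain ⟨W, hW, h⟩ := subgeometry_eq_twisted hσ hK he₀ he₁ hx₀ hN₀ (sub_eq_zero.1 h) hne
    exact ⟨W, hW, Or.inl h⟩
  -- Applying σ turns the third factor into the second with the x's and y's exchanged, hence u₁ and
  -- u₂ exchanged.
  · have h' := congrArg σ h
    simp only [map_sub, map_mul, hσ.cube, map_zero] at h'
    obtain ⟨W, hW, h⟩ := subgeometry_eq_twisted (e := e) (u₁ := u₂) (u₂ := u₁)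
      (x₀ := y₀) (y₀ := x₀) (x₁ := y₁) (y₁ := x₁) hσ hK
      (by rw [he₀, add_comm]) (by rw [he₁, add_comm]) hy₀ hN₀.symm
      (by linear_combination -h') (fun h ↦ hne (by linear_combination -h))
    exact ⟨W, hW, Or.inr h⟩

end Classification

/-! ### Two sublines of one family determine the splash. -/

section Uniqueness

/-- The coefficients `c = α σ(γ) σ²(γ) - β σ(δ) σ²(δ)` and `d = α σ(α) σ²(γ) - β σ(β) σ²(δ)` of a
cubic form vanishing on an `F`-line of `K` are related by the equation of the line. -/
theorem coeff_relation [Finite F] (hq : 2 < Nat.card F) (hσ : IsCubicGenerator σ)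
    {α β γ δ e₁ e₂ : K} (hw : wedge σ e₂ e₁ ≠ 0)
    (h : ∀ t ∈ Submodule.span F {e₁, e₂},
      normForm σ (α * t + γ * σ (σ t)) = normForm σ (β * t + δ * σ (σ t))) :
    (α * σ α * σ (σ γ) - β * σ β * σ (σ δ)) * σ (wedge σ e₂ e₁) =
      (α * σ γ * σ (σ γ) - β * σ δ * σ (σ δ)) * σ (σ (wedge σ e₂ e₁)) := by
  have hw₁ : σ (wedge σ e₂ e₁) ≠ 0 := by simpa using hw
  have hw₂ : σ (σ (wedge σ e₂ e₁)) ≠ 0 := by simpa using hw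
  have h' : ∀ r s : F, normForm σ (algebraMap F K r * (α * e₁ + γ * σ (σ e₁)) +
        algebraMap F K s * (α * e₂ + γ * σ (σ e₂))) =
      normForm σ (algebraMap F K r * (β * e₁ + δ * σ (σ e₁)) +
        algebraMap F K s * (β * e₂ + δ * σ (σ e₂))) := by
    intro r s
    have := h (r • e₁ + s • e₂) (Submodule.mem_span_pair.2 ⟨r, s, rfl⟩)
    simp only [Algebra.smul_def, map_add, map_mul, AlgHom.commutes] at this
    convert this using 2 <;> ring
  -- These values cancel the γ, δ terms in the first factors and the σ²(α), σ²(β) terms in the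
  -- third, leaving only mixed coefficients.
  have h0 := normForm_identity hq h' (σ (σ e₂)) (-σ (σ e₁))
  simp only [map_add, map_mul, hσ.cube] at h0
  apply mul_left_cancel₀ (mul_ne_zero hw₁ hw₂)
  rw [wedge_apply]
  simp only [map_sub, map_mul, hσ.cube]
  linear_combination -h0

theorem twisted_top_eq_of_subset [Finite F] (hq : 2 < Nat.card F) (hK : Module.finrank F K = 3)
    (hσ : IsCubicGenerator σ) {w₁ w₂ : Fin 3 → K} (hu : IsInftyBasis u₁ u₂)
    (hw : IsInftyBasis w₁ w₂) {W₁ W₂ : Submodule F K} (hd₁ : Module.finrank F W₁ = 2)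
    (hd₂ : Module.finrank F W₂ = 2) (hne : W₁ ≠ W₂)
    (h₁ : twisted σ u₁ u₂ W₁ ⊆ twisted σ w₁ w₂ ⊤) (h₂ : twisted σ u₁ u₂ W₂ ⊆ twisted σ w₁ w₂ ⊤) :
    twisted σ w₁ w₂ ⊤ = twisted σ u₁ u₂ ⊤ := by
  obtain ⟨α, β, hu₁⟩ := hw.span u₁ hu.left
  obtain ⟨γ, δ, hu₂⟩ := hw.span u₂ hu.right
  have hcomb : ∀ X Y : K, X • u₁ + Y • u₂ = (α * X + γ * Y) • w₁ + (β * X + δ * Y) • w₂ := by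
    intro X Y
    rw [hu₁, hu₂]
    module
  have hvan : ∀ W : Submodule F K, twisted σ u₁ u₂ W ⊆ twisted σ w₁ w₂ ⊤ → ∀ t ∈ W,
      normForm σ (α * t + γ * σ (σ t)) = normForm σ (β * t + δ * σ (σ t)) := by
    intro W hW t ht
    by_cases h : t • u₁ + σ (σ t) • u₂ = 0
    · rw [(hu.indep _ _ h).1]
      simp
    · exact (mk_mem_twisted_top hσ hw h (hcomb _ _)).1 (hW ⟨t, ht, h, rfl⟩)
  obtain ⟨e₁, he₁, e₂, -, hW₁, hD₁⟩ := hσ.exists_span_pair hd₁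
  obtain ⟨f₁, -, f₂, -, hW₂, hD₂⟩ := hσ.exists_span_pair hd₂
  have r₁ := coeff_relation hq hσ hD₁ (hW₁ ▸ hvan W₁ h₁)
  have r₂ := coeff_relation hq hσ hD₂ (hW₂ ▸ hvan W₂ h₂)
  -- The determinant of the linear system `r₁`, `r₂` in the two mixed coefficients: if it vanished,
  -- the defining elements would be F-proportional and the planes equal.
  have hne' : σ (wedge σ e₂ e₁) * σ (σ (wedge σ f₂ f₁)) -
      σ (wedge σ f₂ f₁) * σ (σ (wedge σ e₂ e₁)) ≠ 0 := by
    rw [sub_ne_zero]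
    intro h
    apply hne
    rw [hW₁, hW₂, hσ.span_pair_eq_traceLine hK hD₁, hσ.span_pair_eq_traceLine hK hD₂]
    exact hσ.traceLine_eq_of_proportional (by simpa using hD₁) (by simpa using hD₂) h
  have hd : α * σ α * σ (σ γ) - β * σ β * σ (σ δ) = 0 := by
    apply mul_right_cancel₀ hne'
    linear_combination σ (σ (wedge σ f₂ f₁)) * r₁ - σ (σ (wedge σ e₂ e₁)) * r₂
  have hc : α * σ γ * σ (σ γ) - β * σ δ * σ (σ δ) = 0 := by
    apply mul_right_cancel₀ hne'
    linear_combination σ (wedge σ f₂ f₁) * r₁ - σ (wedge σ e₂ e₁) * r₂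
  have hd' := congrArg σ hd
  have hd'' := congrArg σ hd'
  have hc' := congrArg σ hc
  have hc'' := congrArg σ hc'
  simp only [map_sub, map_mul, hσ.cube, map_zero] at hd' hd'' hc' hc''
  have he₁0 : e₁ ≠ 0 := by
    rintro rfl
    simp at hD₁
  -- With the mixed terms gone, evaluating at one t = e₁ of `W₁` compares the two remaining
  -- coefficients, as t and σ²(t) have equal norm.
  have hp : normForm σ α - normForm σ β = normForm σ δ - normForm σ γ := by
    have h := hvan W₁ h₁ e₁ he₁
    simp only [normForm, map_add, map_mul, hσ.cube] at h
    apply mul_left_cancel₀ (mt (normForm_eq_zero σ).1 he₁0)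
    simp only [normForm]
    linear_combination h - e₁ ^ 2 * σ e₁ * hc - (σ e₁) ^ 2 * σ (σ e₁) * hc' -
      (σ (σ e₁)) ^ 2 * e₁ * hc'' - e₁ ^ 2 * σ (σ e₁) * hd'' - (σ e₁) ^ 2 * e₁ * hd -
      (σ (σ e₁)) ^ 2 * σ e₁ * hd'
  have hform : ∀ X Y : K, normForm σ (α * X + γ * Y) - normForm σ (β * X + δ * Y) =
      (normForm σ α - normForm σ β) * (normForm σ X - normForm σ Y) := by
    intro X Y
    have hp' := hp
    simp only [normForm, map_add, map_mul] at hp' ⊢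
    linear_combination Y * σ Y * σ (σ Y) * hp' + X * σ X * σ (σ Y) * hd + σ X * σ (σ X) * Y * hd' +
      σ (σ X) * X * σ Y * hd'' + X * σ Y * σ (σ Y) * hc + σ X * σ (σ Y) * Y * hc' +
      σ (σ X) * Y * σ Y * hc''
  -- Otherwise the form would vanish identically, but at `w₁` it takes the value N(1) - N(0) = 1.
  have hm : normForm σ α - normForm σ β ≠ 0 := by
    intro h0
    obtain ⟨X, Y, hXY⟩ := hu.span w₁ hw.left
    have h1 : (1 : K) • w₁ + (0 : K) • w₂ = (α * X + γ * Y) • w₁ + (β * X + δ * Y) • w₂ := by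
      rw [← hcomb, ← hXY]; simp
    have h2 := hform X Y
    rw [← (hw.eq_of_eq h1).1, ← (hw.eq_of_eq h1).2, h0] at h2
    simp [normForm] at h2
  ext P
  induction P using Projectivization.ind with
  | h v hv =>
    by_cases h2 : v 2 = 0
    · obtain ⟨X, Y, hXY⟩ := hu.span v h2
      rw [mk_mem_twisted_top hσ hu hv hXY,
        mk_mem_twisted_top hσ hw hv (hXY.trans (hcomb X Y)), ← sub_eq_zero, hform X Y,
        mul_eq_zero, or_iff_right hm, sub_eq_zero]
    · constructor <;> intro h <;> obtain ⟨X, Y, rfl⟩ := exists_coords_of_mk_mem_twisted hv h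
      · simp [hw.left, hw.right] at h2
      · simp [hu.left, hu.right] at h2

end Uniqueness

/-! ### Parametrization of exterior subplanes, their pencils and splashes. -/

/-- The vector `x w₀ + σ(x) w₁ - σ²(x) w₂`. -/
def subplaneVec (σ : K →ₐ[F] K) (w₀ w₁ w₂ : Fin 3 → K) (x : K) : Fin 3 → K :=
  x • w₀ + σ x • w₁ - σ (σ x) • w₂

/-- A parametrization of an exterior order-`q`-subplane by the elements of `K`, for which the
parameter is the `z`-coordinate. -/
structure IsSubplaneFrame (σ : K →ₐ[F] K) (π : Set (Plane K)) (w₀ w₁ w₂ : Fin 3 → K) : Prop where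
  one : w₀ 2 = 1
  basis : IsInftyBasis w₁ w₂
  mem_iff : ∀ P, P ∈ π ↔
    ∃ x, ∃ h : subplaneVec σ w₀ w₁ w₂ x ≠ 0, P = Projectivization.mk K _ h

theorem mk_mem_lineAtInfinity {v : Fin 3 → K} (hv : v ≠ 0) :
    Projectivization.mk K v hv ∈ lineAtInfinity K ↔ v 2 = 0 := by
  simp [lineAtInfinity, Submodule.span_le]

theorem exists_isSubplaneFrame {σ : K →ₐ[F] K} (hσ : IsCubicGenerator σ)
    (hK : Module.finrank F K = 3) {π : Set (Plane K)} (hπ : IsExteriorSubplane F π) :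
    ∃ w₀ w₁ w₂, IsSubplaneFrame σ π w₀ w₁ w₂ := by
  obtain ⟨⟨e, he, rfl⟩, hdis⟩ := hπ
  have : FiniteDimensional F K := Module.finite_of_finrank_pos (by omega)
  have heF : LinearIndependent F e := he.restrict_scalars' F
  -- An F-relation between the z-coordinates would give a point of the subplane at infinity.
  have hα : LinearIndependent F (fun i ↦ e i 2) := by
    rw [Fintype.linearIndependent_iff]
    intro c hc
    refine Fintype.linearIndependent_iff.1 heF c ?_
    by_contra h
    refine Set.disjoint_left.1 hdis ⟨c, h, rfl⟩ ?_
    rw [mk_mem_lineAtInfinity]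
    simpa using hc
  let b := basisOfLinearIndependentOfCardEqFinrank hα (by simp [hK])
  have hb : ∀ i, b i = e i 2 := by simp [b]
  -- `L` takes the coefficients of a map x ↦ v₀ x + v₁ σ(x) - v₂ σ²(x) to its values on `b`.
  -- Bijectivity means every F-linear map K → K has this form, in particular each coordinate
  -- function of the subplane.
  let L : (Fin 3 → K) →ₗ[K] (Fin 3 → K) := LinearMap.pi fun i ↦
    (b i) • LinearMap.proj 0 + (σ (b i)) • LinearMap.proj 1 - (σ (σ (b i))) • LinearMap.proj 2
  have hL : ∀ v i, L v i = b i * v 0 + σ (b i) * v 1 - σ (σ (b i)) * v 2 := by simp [L]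
  have hinj : Function.Injective L := by
    rw [← LinearMap.ker_eq_bot, LinearMap.ker_eq_bot']
    intro v hv
    let φ : K →ₗ[F] K := LinearMap.mulLeft F (v 0) + LinearMap.mulLeft F (v 1) ∘ₗ σ.toLinearMap -
      LinearMap.mulLeft F (v 2) ∘ₗ σ.toLinearMap ∘ₗ σ.toLinearMap
    have hφ : φ = 0 := b.ext fun i ↦ by
      have := congrFun hv i
      rw [hL, Pi.zero_apply] at this
      simp only [φ, LinearMap.sub_apply, LinearMap.add_apply, LinearMap.mulLeft_apply,
        LinearMap.comp_apply, AlgHom.toLinearMap_apply, LinearMap.zero_apply]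
      linear_combination this
    have h := hσ.indep (v 0) (v 1) (-v 2) fun x ↦ by
      have := LinearMap.congr_fun hφ x
      simp only [φ, LinearMap.sub_apply, LinearMap.add_apply, LinearMap.mulLeft_apply,
        LinearMap.comp_apply, AlgHom.toLinearMap_apply, LinearMap.zero_apply] at this
      linear_combination this
    ext i
    fin_cases i
    · exact h.1
    · exact h.2.1
    · exact neg_eq_zero.1 h.2.2
  have hsurj : Function.Surjective L := LinearMap.injective_iff_surjective.1 hinj
  choose w hw using fun k : Fin 3 ↦ hsurj fun i ↦ e i k
  have hw2 : w 2 = ![1, 0, 0] := hinj <| by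
    rw [hw]
    ext i
    rw [hL, ← hb]
    simp
  have hvec : ∀ i, e i = subplaneVec σ (fun k ↦ w k 0) (fun k ↦ w k 1) (fun k ↦ w k 2) (b i) := by
    intro i
    ext k
    have := congrFun (hw k) i
    rw [hL] at this
    simp only [subplaneVec, Pi.add_apply, Pi.sub_apply, Pi.smul_apply, smul_eq_mul]
    exact this.symm
  have hspan : (⊤ : Submodule K (Fin 3 → K)) ≤
      Submodule.span K (Set.range ![fun k ↦ w k 0, fun k ↦ w k 1, fun k ↦ w k 2]) := by
    rw [← he.span_eq_top_of_card_eq_finrank' (by simp), Submodule.span_le]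
    rintro _ ⟨i, rfl⟩
    rw [hvec, subplaneVec]
    have hm : ∀ j, ![fun k ↦ w k 0, fun k ↦ w k 1, fun k ↦ w k 2] j ∈
      Submodule.span K (Set.range ![fun k ↦ w k 0, fun k ↦ w k 1, fun k ↦ w k 2]) :=
      fun j ↦ Submodule.subset_span ⟨j, rfl⟩
    exact sub_mem (add_mem (Submodule.smul_mem _ _ (hm 0)) (Submodule.smul_mem _ _ (hm 1)))
      (Submodule.smul_mem _ _ (hm 2))
  have hind := linearIndependent_of_top_le_span_of_card_eq_finrank hspan (by simp)
  have hsum : ∀ c : Fin 3 → F, ∑ i, c i • e i =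
      subplaneVec σ (fun k ↦ w k 0) (fun k ↦ w k 1) (fun k ↦ w k 2) (∑ i, c i • b i) := by
    intro c
    simp only [hvec, subplaneVec, Fin.sum_univ_three, map_add, map_smul, add_smul, smul_add, smul_sub,
      smul_assoc]
    abel
  refine ⟨fun k ↦ w k 0, fun k ↦ w k 1, fun k ↦ w k 2, by simp [hw2],
    ⟨by simp [hw2], by simp [hw2], fun a c h ↦ ?_, fun v hv ↦ ?_⟩, fun P ↦ ⟨?_, ?_⟩⟩
  · have := Fintype.linearIndependent_iff.1 hind ![0, a, c] (by
      simpa [Fin.sum_univ_three] using h)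
    exact ⟨this 1, this 2⟩
  · obtain ⟨c, hc⟩ := (Submodule.mem_span_range_iff_exists_fun K).1
      (hspan (Submodule.mem_top (x := v)))
    have h0 := congrFun hc 2
    rw [hv] at h0
    simp [Fin.sum_univ_three, hw2] at h0
    refine ⟨c 1, c 2, ?_⟩
    rw [← hc]
    simp [Fin.sum_univ_three, h0]
  · rintro ⟨c, h, rfl⟩
    exact ⟨_, hsum c ▸ h, by simp only [hsum]⟩
  · rintro ⟨x, h, rfl⟩
    have hx : x = ∑ i, b.repr x i • b i := (b.sum_repr x).symm
    refine ⟨b.repr x, ?_, ?_⟩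
    · rw [hsum, ← hx]
      exact h
    · simp only [hsum, ← hx]

namespace IsSubplaneFrame

variable {σ : K →ₐ[F] K} {π : Set (Plane K)} {w₀ w₁ w₂ : Fin 3 → K}
  (hw : IsSubplaneFrame σ π w₀ w₁ w₂)
include hw

theorem subplaneVec_two (x : K) : subplaneVec σ w₀ w₁ w₂ x 2 = x := by
  simp [subplaneVec, hw.one, hw.basis.left, hw.basis.right]

theorem subplaneVec_ne_zero {x : K} (hx : x ≠ 0) : subplaneVec σ w₀ w₁ w₂ x ≠ 0 := fun h ↦
  hx (by rw [← hw.subplaneVec_two x, h, Pi.zero_apply])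

-- The combination that kills the z-coordinate. The minus sign in `subplaneVec` makes the second
-- coefficient exactly σ² of the first.
omit hw in
theorem smul_subplaneVec_sub (hσ : IsCubicGenerator σ) (x y : K) :
    y • subplaneVec σ w₀ w₁ w₂ x - x • subplaneVec σ w₀ w₁ w₂ y =
      wedge σ x y • w₁ + σ (σ (wedge σ x y)) • w₂ := by
  rw [wedge_apply]
  simp only [subplaneVec, map_sub, map_mul, hσ.cube]
  module

theorem pencilSubline_eq (hσ : IsCubicGenerator σ) {x : K}
    (h : subplaneVec σ w₀ w₁ w₂ x ≠ 0) :
    pencilSubline π (Projectivization.mk K _ h) = twisted σ w₁ w₂ (LinearMap.range (wedge σ x)) := by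
  have hx : x ≠ 0 := by
    rintro rfl
    simp [subplaneVec] at h
  ext Q
  constructor
  · rintro ⟨hQ, P', hP', hne, hline⟩
    obtain ⟨y, hy, rfl⟩ := (hw.mem_iff _).1 hP'
    induction Q using Projectivization.ind with
    | h v hv =>
      rw [mk_mem_lineAtInfinity] at hQ
      rw [OnLine, Projectivization.submodule_mk, Projectivization.submodule_mk,
        Projectivization.submodule_mk, Submodule.span_singleton_le_iff_mem,
        ← Submodule.span_union, Set.singleton_union, Submodule.mem_span_pair] at hline
      obtain ⟨p, r, rfl⟩ := hline
      simp only [Pi.add_apply, Pi.smul_apply, hw.subplaneVec_two, smul_eq_mul] at hQ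
      have hp : p = (-r / x) * y := by
        field_simp
        linear_combination hQ
      have hv' : p • subplaneVec σ w₀ w₁ w₂ x + r • subplaneVec σ w₀ w₁ w₂ y =
          (-r / x * wedge σ x y) • w₁ + (-r / x * σ (σ (wedge σ x y))) • w₂ := by
        have hr : r = -((-r / x) * x) := by field_simp
        rw [mul_smul, mul_smul, ← smul_add, ← smul_subplaneVec_sub hσ, smul_sub, smul_smul,
          smul_smul, ← hp, sub_eq_add_neg, ← neg_smul, ← hr]
      exact (mk_mem_twisted hw.basis hv hv').2 ⟨_, _, ⟨y, rfl⟩, rfl, rfl⟩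
  · rintro ⟨_, ⟨y, rfl⟩, h0, rfl⟩
    have hy : y ≠ 0 := by
      rintro rfl
      simp at h0
    refine ⟨?_, _, (hw.mem_iff _).2 ⟨y, hw.subplaneVec_ne_zero hy, rfl⟩, fun hP ↦ ?_, ?_⟩
    · rw [mk_mem_lineAtInfinity]
      simp [hw.basis.left, hw.basis.right]
    · rw [Projectivization.mk_eq_mk_iff'] at hP
      obtain ⟨a, ha⟩ := hP
      have ha2 := congrFun ha 2
      rw [Pi.smul_apply, hw.subplaneVec_two, hw.subplaneVec_two, smul_eq_mul] at ha2
      apply h0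
      rw [← smul_subplaneVec_sub hσ, ← ha, ← ha2, smul_smul, mul_comm, sub_self]
    · rw [OnLine, Projectivization.submodule_mk, Projectivization.submodule_mk,
        Projectivization.submodule_mk, Submodule.span_singleton_le_iff_mem,
        ← Submodule.span_union, Set.singleton_union, Submodule.mem_span_pair,
        ← smul_subplaneVec_sub hσ]
      exact ⟨y, -x, by rw [neg_smul, sub_eq_add_neg]⟩

theorem mem_pencilFamily_iff (hσ : IsCubicGenerator σ) (hK : Module.finrank F K = 3)
    {b : Set (Plane K)} : b ∈ pencilFamily π ↔
      ∃ W : Submodule F K, Module.finrank F W = 2 ∧ b = twisted σ w₁ w₂ W := by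
  constructor
  · rintro ⟨P, hP, rfl⟩
    obtain ⟨x, h, rfl⟩ := (hw.mem_iff _).1 hP
    have hx : x ≠ 0 := by
      rintro rfl
      simp [subplaneVec] at h
    refine ⟨_, ?_, hw.pencilSubline_eq hσ h⟩
    rw [hσ.range_wedge hK hx, hσ.finrank_traceLine hK (by simpa using hx)]
  · rintro ⟨W, hW, rfl⟩
    obtain ⟨e₁, -, e₂, -, hs, hD⟩ := hσ.exists_span_pair hW
    have hx : σ (σ (wedge σ e₂ e₁)) ≠ 0 := by simpa using hD
    -- The parameter σ²(w), with w = `wedge σ e₂ e₁`, is chosen because its pencil is the trace line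
    -- of σ²(σ²(w)) = σ(w), which is `W`.
    refine ⟨_, (hw.mem_iff _).2 ⟨_, hw.subplaneVec_ne_zero hx, rfl⟩, ?_⟩
    rw [hw.pencilSubline_eq hσ, hσ.range_wedge hK hx, hσ.cube, hs, hσ.span_pair_eq_traceLine hK hD]

theorem splash_eq (hσ : IsCubicGenerator σ) (hK : Module.finrank F K = 3) :
    splash π = twisted σ w₁ w₂ ⊤ := by
  have : FiniteDimensional F K := Module.finite_of_finrank_pos (by omega)
  ext Q
  constructor
  · rintro ⟨hQ, P, hP, P', hP', hne, hline⟩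
    obtain ⟨W, -, hW⟩ := (hw.mem_pencilFamily_iff hσ hK).1 ⟨P, hP, rfl⟩
    exact twisted_mono le_top (hW ▸ ⟨hQ, P', hP', hne, hline⟩ : Q ∈ twisted σ w₁ w₂ W)
  · rintro ⟨t, -, h0, rfl⟩
    have ht : t ≠ 0 := by
      rintro rfl
      simp at h0
    have hr : Module.finrank F (traceLine σ t) ≠ 0 := by
      rw [hσ.finrank_traceLine hK ht]
      norm_num
    rw [Ne, Submodule.finrank_eq_zero, Submodule.eq_bot_iff] at hr
    push Not at hr
    obtain ⟨a, ha, ha0⟩ := hr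
    -- Tr(at) = 0 is symmetric in `a` and `t`, so every point of the norm set lies on some pencil
    -- subline.
    have hta : t ∈ traceLine σ a := by
      rw [mem_traceLine] at ha ⊢
      linear_combination ha
    obtain ⟨P, hP, h⟩ := (hw.mem_pencilFamily_iff hσ hK).2
      ⟨_, hσ.finrank_traceLine hK ha0, rfl⟩
    have hmem : Projectivization.mk K _ h0 ∈ pencilSubline π P := h ▸ ⟨t, hta, h0, rfl⟩
    obtain ⟨hQ, P', hP', hne, hline⟩ := hmem
    exact ⟨hQ, P, hP, P', hP', hne, hline⟩

end IsSubplaneFrame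

end Splash

theorem theorem5p2 {F K : Type*} [Field F] [Field K] [Algebra F K] [Finite F]
    (hq : 2 < Nat.card F) (hK : Module.finrank F K = 3)
    (S : Set (Splash.Plane K)) (hS : Splash.IsExteriorSplash F S)
    (B : Set (Set (Splash.Plane K))) (hB : Splash.IsFamily F S B)
    (b₁ b₂ : Set (Splash.Plane K)) (hb₁ : b₁ ∈ B) (hb₂ : b₂ ∈ B) (hne : b₁ ≠ b₂)
    (S' : Set (Splash.Plane K)) (hS' : Splash.IsExteriorSplash F S')
    (h₁ : b₁ ⊆ S') (h₂ : b₂ ⊆ S') :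
    S' = S := by
  obtain ⟨σ, hσ⟩ := Splash.exists_isCubicGenerator (F := F) hK
  obtain ⟨π, hπ, hSπ, hB⟩ := hB
  obtain ⟨π', hπ', rfl⟩ := hS'
  obtain ⟨w₀, w₁, w₂, hw⟩ := Splash.exists_isSubplaneFrame hσ hK hπ
  obtain ⟨v₀, v₁, v₂, hv⟩ := Splash.exists_isSubplaneFrame hσ hK hπ'
  rw [hv.splash_eq hσ hK] at h₁ h₂ ⊢
  rw [hw.splash_eq hσ hK] at hSπ
  subst hSπ
  rcases hB with rfl | rfl
  · obtain ⟨W₁, hW₁, rfl⟩ := (hw.mem_pencilFamily_iff hσ hK).1 hb₁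
    obtain ⟨W₂, hW₂, rfl⟩ := (hw.mem_pencilFamily_iff hσ hK).1 hb₂
    exact Splash.twisted_top_eq_of_subset hq hK hσ hw.basis hv.basis hW₁ hW₂
      (fun h ↦ hne (h ▸ rfl)) h₁ h₂
  · have hopp : ∀ b ∈ Splash.sublinesOf F (Splash.twisted σ w₁ w₂ ⊤) \ Splash.pencilFamily π,
        ∃ W : Submodule F K, Module.finrank F W = 2 ∧ b = Splash.twisted σ w₂ w₁ W := by
      rintro b ⟨⟨hb, hbS⟩, hnb⟩
      obtain ⟨W, hW, h | h⟩ := hb.eq_twisted hq hK hσ hw.basis hbS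
      · exact absurd ((hw.mem_pencilFamily_iff hσ hK).2 ⟨W, hW, h⟩) hnb
      · exact ⟨W, hW, h⟩
    obtain ⟨W₁, hW₁, rfl⟩ := hopp _ hb₁
    obtain ⟨W₂, hW₂, rfl⟩ := hopp _ hb₂
    -- Exchanging `w₁` and `w₂` preserves the splash and reduces to the argument for the pencil
    -- family.
    rw [← Splash.twisted_top_comm hσ hw.basis]
    exact Splash.twisted_top_eq_of_subset hq hK hσ hw.basis.symm hv.basis hW₁ hW₂
      (fun h ↦ hne (h ▸ rfl)) h₁ h₂
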